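/- Let $k$ be a commutative domain; all algebras are associative unital $k$-algebras, not necessarily commutative, and all isomorphisms are isomorphisms of $k$-algebras. For an algebra $A$, variables in $A[t]$ and $A[t_1,\dots,t_d]$ commute with each other and with $A$. The rank of a finitely generated $k$-module $M$ is $\operatorname{rank}_k M=\dim_{\operatorname{Frac}(k)}(M\otimes_k\operatorname{Frac}(k))$, and $$\operatorname{GKdim}A=\sup_V\ \limsup_{n\to\infty}\ \log_n \operatorname{rank}_k(V^n)\in[-\infty,\infty],$$ where $V$ runs over the finitely generated $k$-submodules of $A$ and $\log_n 0=-\infty$. We say that $A$ has finite GK-dimension if $\operatorname{GKdim}A$ is a real number. Let $\mathrm{LND}(A)$ be the set of $k$-linear derivations $\delta$ of $A$ such that for every $a\in A$ there is an $n$ with $\delta^n(a)=0$. A higher derivation of $A$ is a sequence $\partial=(\partial_i)_{i\ge 0}$ of $k$-linear endomorphisms of $A$ with $\partial_0=\mathrm{id}_A$ and $\partial_n(ab)=\sum_{i=0}^n\partial_i(a)\partial_{n-i}(b)$ for all $n\ge 0$ and $a,b\in A$; its kernel is $\ker\partial=\bigcap_{i\ge1}\ker\partial_i$. It is iterative if $\partial_i\partial_j=\binom{i+j}{i}\partial_{i+j}$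 for all $i,j\ge 0$. It is locally nilpotent if for every $a\in A$ one has $\partial_i(a)=0$ for all sufficiently large $i$, and the map $A[t]\to A[t]$ determined by $a\mapsto\sum_{i\ge 0}\partial_i(a)t^i$ ($a\in A$) and $t\mapsto t$ is a $k$-algebra automorphism of $A[t]$. Let $\mathrm{LND}^H(A)$ be the set of locally nilpotent higher derivations of $A$, and $\mathrm{LND}^I(A)$ the set of those that are iterative. For $*$ blank, $H$ or $I$ put $$\mathrm{ML}^*(A)=\bigcap_{\delta\in\mathrm{LND}^*(A)}\ker\delta .$$ The algebra $A$ is strongly $\mathrm{LND}^*$-rigid if $\mathrm{ML}^*(A[t_1,\dots,t_d])=A$ for all $d\ge1$. It is cancellative if, for every algebra $B$, $A[t]\cong B[t]$ implies $A\cong B$; it is strongly cancellative if, for every $d\ge1$ and every algebra $B$, $A[t_1,\dots,t_d]\cong B[t_1,\dots,t_d]$ implies $A\cong B$. **Theorem.** Let $A$ be a $k$-algebra that is a domain, is finitely generated as a $k$-algebra and has finite GK-dimension. Let $*$ be blank, $H$ or $I$; if $*$ is blank, assume moreover that $A$ contains $\mathbb Z$ (that is, $A$ has characteristic zero). 1.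 If $A$ is strongly $\mathrm{LND}^*$-rigid, then $A$ is strongly cancellative. 2. If $\mathrm{ML}^*(A[t])=A$, then $A$ is cancellative. -/

import Mathlib

universe u v w

open scoped TensorProduct Polynomial

noncomputable section

namespace Cancellation

/-- The polynomial ring `A[t₁, …, t_d]` over a possibly noncommutative ring `A`, in `d` variables
that commute with each other and with the coefficients: the monoid algebra over `A` of the
monoid of exponent vectors (this is how `MvPolynomial` is defined for commutative `A`). -/
abbrev MvPoly (A : Type v) [Ring A] (d : ℕ) : Type v :=
  AddMonoidAlgebra A (Fin d →₀ ℕ)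

/-- The rank of a module over a commutative domain `k`:
the dimension of `Frac(k) ⊗ M` over `Frac(k)`. -/
def rk (k : Type u) [CommRing k] [IsDomain k] (M : Type v) [AddCommGroup M] [Module k M] : ℕ :=
  Module.finrank (FractionRing k) (FractionRing k ⊗[k] M)

/-- The Gelfand-Kirillov dimension `sup_V limsup_n log_n rank_k (V ^ n)`, where `V` runs over the
finitely generated `k`-submodules of `A`. It takes values in `[-∞, ∞]`, with `log 0 = -∞`. -/
def GKdim (k : Type u) [CommRing k] [IsDomain k] (A : Type v) [Ring A] [Algebra k A] : EReal :=
  ⨆ (V : Submodule k A) (_ : V.FG),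
    Filter.limsup
      (fun n : ℕ => ENNReal.log (rk k ↥(V ^ n) : ENNReal) / ((Real.log n : ℝ) : EReal))
      Filter.atTop

/-- The GK-dimension is a real number (neither `∞` nor `-∞`). -/
def HasFiniteGKdim (k : Type u) [CommRing k] [IsDomain k] (A : Type v) [Ring A] [Algebra k A] :
    Prop :=
  ∃ r : ℝ, GKdim k A = (r : EReal)

section Derivations

variable (k : Type u) [CommRing k] (A : Type v) [Ring A] [Algebra k A]

/-- The set `LND(A)` of locally nilpotent `k`-derivations of `A`. -/
def LND : Set (A →ₗ[k] A) :=
  {δ | (∀ a b : A, δ (a * b) = δ a * b + a * δ b) ∧ ∀ a : A, ∃ n : ℕ, (δ ^ n) a = 0}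

/-- The set `Der^H(A)` of higher (Hasse-Schmidt) derivations of `A`. -/
def DerH : Set (ℕ → A →ₗ[k] A) :=
  {D | D 0 = LinearMap.id ∧ ∀ (n : ℕ) (a b : A),
    D n (a * b) = ∑ i ∈ Finset.range (n + 1), D i a * D (n - i) b}

/-- The set `LND^H(A)` of locally nilpotent higher derivations. The second clause asks for
`D i a = 0` when `i` is large; the third one asks that the map `A[t] → A[t]` determined by
`a ↦ ∑ᵢ (D i a) tⁱ` for `a ∈ A` and by `t ↦ t` be an automorphism of the algebra `A[t]`. -/
def LNDH : Set (ℕ → A →ₗ[k] A) :=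
  {D | D ∈ DerH k A ∧
    (∀ a : A, ∃ n : ℕ, ∀ i, n ≤ i → D i a = 0) ∧
    ∃ G : A[X] ≃ₐ[k] A[X],
      (∀ (a : A) (i : ℕ), (G (Polynomial.C a)).coeff i = D i a) ∧ G Polynomial.X = Polynomial.X}

/-- The set `LND^I(A)` of locally nilpotent iterative higher derivations. -/
def LNDI : Set (ℕ → A →ₗ[k] A) :=
  {D | D ∈ LNDH k A ∧ ∀ i j : ℕ, D i ∘ₗ D j = (i + j).choose i • D (i + j)}

/-- The kernel of a higher derivation: the intersection of the kernels of `D i`, `i ≥ 1`. -/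
def kerH (D : ℕ → A →ₗ[k] A) : Submodule k A :=
  ⨅ (i : ℕ) (_ : 1 ≤ i), LinearMap.ker (D i)

end Derivations

/-- The three values of the decoration `*`. -/
inductive Star
  | blank
  | H
  | I

/-- The Makar-Limanov invariant `ML^*(A)`. -/
def ML (s : Star) (k : Type u) [CommRing k] (A : Type v) [Ring A] [Algebra k A] :
    Submodule k A :=
  match s with
  | Star.blank => ⨅ δ ∈ LND k A, LinearMap.ker δ
  | Star.H => ⨅ D ∈ LNDH k A, kerH k A D
  | Star.I => ⨅ D ∈ LNDI k A, kerH k A D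

/-- The copy of `A` (the constants) inside `A[t]`. -/
def constPoly (k : Type u) [CommRing k] (A : Type v) [Ring A] [Algebra k A] :
    Submodule k A[X] :=
  LinearMap.range (Polynomial.CAlgHom : A →ₐ[k] A[X]).toLinearMap

/-- The copy of `A` (the constants) inside `A[t₁, …, t_d]`. -/
def constMvPoly (k : Type u) [CommRing k] (A : Type v) [Ring A] [Algebra k A] (d : ℕ) :
    Submodule k (MvPoly A d) :=
  LinearMap.range (AddMonoidAlgebra.singleZeroAlgHom : A →ₐ[k] MvPoly A d).toLinearMap

/-- `A` is strongly `LND^*`-rigid: `ML^*(A[t₁, …, t_d]) = A` for all `d ≥ 1`. -/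
def IsStronglyRigid (s : Star) (k : Type u) [CommRing k] (A : Type v) [Ring A] [Algebra k A] :
    Prop :=
  ∀ d : ℕ, 1 ≤ d → ML s k (MvPoly A d) = constMvPoly k A d

/-- `A` is cancellative, tested against all `k`-algebras `B` in the universe `w`. -/
def IsCancellative (k : Type u) [CommRing k] (A : Type v) [Ring A] [Algebra k A] : Prop :=
  ∀ (B : Type w) [Ring B] [Algebra k B], Nonempty (A[X] ≃ₐ[k] B[X]) → Nonempty (A ≃ₐ[k] B)

/-- `A` is strongly cancellative, tested against all `k`-algebras `B` in the universe `w`. -/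
def IsStronglyCancellative (k : Type u) [CommRing k] (A : Type v) [Ring A] [Algebra k A] : Prop :=
  ∀ d : ℕ, 1 ≤ d → ∀ (B : Type w) [Ring B] [Algebra k B],
    Nonempty (MvPoly A d ≃ₐ[k] MvPoly B d) → Nonempty (A ≃ₐ[k] B)

end Cancellation

end

/-! Let `φ` identify `A[t₁, …, t_d]` with `B[t₁, …, t_d]`. The Hasse derivatives in the variables
show that the Makar-Limanov invariant of `B[t₁, …, t_d]` lies in `B` (`ML_le_constMvPoly`), and
isomorphisms respect this invariant. By rigidity it contains `A` on the other side, so `φ` maps `A`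
into `B`.

Growth forces equality (`symm_single_zero_eq_single_zero`). Otherwise some `β` in `B` has a
nonconstant preimage `z`, whose powers are independent over `A`. For a generating submodule `V`
containing `1`, the products `a * z ^ i * φ⁻¹(t ^ b)`, with `a ∈ V ^ n` and all exponents at most
`n`, span rank `(n + 1) ^ (d + 1) * rank (V ^ n)`. They lie in a box of rank at most `(c * n + 1) ^
d * rank (V ^ (c * n))`, with `c` independent of `n`. Hence `rank (V ^ n) * (n + 1) ≤ c ^ d * rank
(V ^ (c * n))`, which is impossible for a polynomially bounded function. -/

noncomputable section

namespace Cancellation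

/-! ### Ranks and growth functions -/

section Rank

variable (k : Type u) [CommRing k] [IsDomain k] (M : Type v) [AddCommGroup M] [Module k M]

theorem rk_eq_finrank : rk k M = Module.finrank k M :=
  (TensorProduct.isBaseChange k M (FractionRing k)).finrank_eq

/-- `M` need not be free, so the count is made after base change to the fraction field. -/
theorem finrank_fun [Module.Finite k M] (ι : Type) [Fintype ι] :
    Module.finrank k (ι → M) = Fintype.card ι * Module.finrank k M := by
  have h := TensorProduct.isBaseChange k M (FractionRing k)
  have h' := IsBaseChange.pi (ι := ι) (fun _ => TensorProduct.mk k (FractionRing k) M 1) fun _ => h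
  rw [← h'.finrank_eq, ← h.finrank_eq, Module.finrank_pi_fintype]
  simp

end Rank

/-- A function that satisfies `f n * (n + 1) ≤ C * f (c * n)` grows faster than any power. -/
theorem not_polynomially_bounded {f : ℕ → ℕ} (hf : ∀ n, 1 ≤ f n) {c C : ℕ} (hc : 1 ≤ c)
    (h : ∀ n, f n * (n + 1) ≤ C * f (c * n)) (R : ℕ) :
    ¬ ∃ M N : ℕ, ∀ n, N ≤ n → f n ≤ M * n ^ R := by
  induction R with
  | zero =>
    rintro ⟨M, N, hM⟩
    -- At this argument the left side is at least `N + C * M + 1`, the right side at most `C * M`.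
    have h1 := h (N + C * M)
    have h2 : f (c * (N + C * M)) ≤ M := by
      simpa using hM (c * (N + C * M))
        ((Nat.le_add_right N _).trans (Nat.le_mul_of_pos_left _ hc))
    have h3 := Nat.mul_le_mul_left C h2
    have h4 := Nat.mul_le_mul_right (N + C * M + 1) (hf (N + C * M))
    omega
  | succ R ih =>
    rintro ⟨M, N, hM⟩
    -- The bound at `c * n` gives one at `n` with an extra factor `n` on the left; cancelling it
    -- lowers the exponent. The shift `N + 1` makes `n` positive.
    refine ih ⟨C * M * c ^ (R + 1), N + 1, fun n hn => ?_⟩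
    have h1 := h n
    have h2 := Nat.mul_le_mul_left C (hM (c * n) (by nlinarith))
    have h3 : f n * n ≤ C * M * c ^ (R + 1) * n ^ R * n := by
      calc f n * n ≤ f n * (n + 1) := Nat.mul_le_mul_left _ (Nat.le_succ n)
        _ ≤ C * (M * (c * n) ^ (R + 1)) := h1.trans h2
        _ = _ := by ring
    exact Nat.le_of_mul_le_mul_right h3 (by omega)

theorem exists_fg_forall_mem_pow {k : Type u} [CommRing k] {A : Type v} [Ring A] [Algebra k A]
    (hfg : Algebra.FiniteType k A) :
    ∃ V : Submodule k A, V.FG ∧ 1 ≤ V ∧ ∀ a : A, ∃ n : ℕ, a ∈ V ^ n := by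
  obtain ⟨s, hs⟩ := hfg.out
  classical
  refine ⟨Submodule.span k ((insert 1 s : Finset A) : Set A), ⟨_, rfl⟩, ?_, fun a => ?_⟩
  · rw [Submodule.one_le]
    exact Submodule.subset_span (by simp)
  set V := Submodule.span k ((insert 1 s : Finset A) : Set A)
  have h1 : (1 : Submodule k A) ≤ V := by
    rw [Submodule.one_le]
    exact Submodule.subset_span (by simp)
  have ha : a ∈ Algebra.adjoin k (s : Set A) := hs ▸ Algebra.mem_top
  induction ha using Algebra.adjoin_induction with
  | mem x hx => exact ⟨1, by rw [pow_one]; exact Submodule.subset_span (by simp [hx])⟩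
  | algebraMap r => exact ⟨0, by rw [pow_zero]; exact Submodule.algebraMap_mem r⟩
  | add x y _ _ hx hy =>
    obtain ⟨m, hm⟩ := hx
    obtain ⟨n, hn⟩ := hy
    exact ⟨m + n, add_mem (pow_le_pow_right' h1 (by omega) hm)
      (pow_le_pow_right' h1 (by omega) hn)⟩
  | mul x y _ _ hx hy =>
    obtain ⟨m, hm⟩ := hx
    obtain ⟨n, hn⟩ := hy
    exact ⟨m + n, by rw [pow_add]; exact Submodule.mul_mem_mul hm hn⟩

/-! ### Consequences of finite GK-dimension -/

section GK

variable {k : Type u} [CommRing k] [IsDomain k] {A : Type v} [Ring A] [Algebra k A]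

/-- A nonzero scalar killing `A` makes every finitely generated submodule torsion, so all ranks
vanish and the GK-dimension is `-∞`. -/
theorem algebraMap_injective_of_hasFiniteGKdim [IsDomain A] (h : HasFiniteGKdim k A) :
    Function.Injective (algebraMap k A) := by
  rw [injective_iff_map_eq_zero]
  by_contra! hc
  obtain ⟨c, hc0, hc⟩ := hc
  have hrk : ∀ V : Submodule k A, V.FG → rk k V = 0 := fun V hV => by
    have := Module.Finite.of_fg hV
    rw [rk_eq_finrank, Module.finrank_eq_zero_iff_isTorsion]
    intro x
    refine ⟨⟨c, mem_nonZeroDivisors_of_ne_zero hc⟩, ?_⟩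
    ext
    simp [Submonoid.smul_def, Algebra.smul_def, hc0]
  obtain ⟨r, hr⟩ := h
  have : GKdim k A = ⊥ := by
    simp only [GKdim, iSup_eq_bot]
    intro V hV
    have : (fun n : ℕ => ENNReal.log (rk k ↥(V ^ n) : ENNReal) / ((Real.log n : ℝ) : EReal))
        =ᶠ[Filter.atTop] fun _ => ⊥ := by
      filter_upwards [Filter.eventually_ge_atTop 2] with n hn
      have hlog : (0 : ℝ) < Real.log n := Real.log_pos (by exact_mod_cast hn)
      rw [hrk _ (hV.pow n)]
      simp only [Nat.cast_zero, ENNReal.log_zero]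
      exact EReal.bot_div_of_pos_ne_top (by exact_mod_cast hlog) (EReal.coe_ne_top _)
    rw [Filter.limsup_congr this, Filter.limsup_const]
  rw [this] at hr
  exact EReal.coe_ne_bot r hr.symm

theorem HasFiniteGKdim.exists_finrank_pow_le (h : HasFiniteGKdim k A) {V : Submodule k A}
    (hV : V.FG) :
    ∃ R N : ℕ, ∀ n, N ≤ n → Module.finrank k ↥(V ^ n) ≤ n ^ R := by
  obtain ⟨r, hr⟩ := h
  obtain ⟨R, hR⟩ := exists_nat_gt r
  have h1 : Filter.limsup
      (fun n : ℕ => ENNReal.log (rk k ↥(V ^ n) : ENNReal) / ((Real.log n : ℝ) : EReal))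
      Filter.atTop < ((R : ℝ) : EReal) := by
    refine lt_of_le_of_lt ?_ (EReal.coe_lt_coe_iff.2 hR)
    rw [← hr]
    exact le_iSup₂_of_le V hV le_rfl
  have h2 := Filter.eventually_lt_of_limsup_lt h1
  obtain ⟨N, hN⟩ := Filter.eventually_atTop.1 (h2.and (Filter.eventually_ge_atTop 2))
  refine ⟨R, N, fun n hn => ?_⟩
  obtain ⟨h3, h4⟩ := hN n hn
  rw [rk_eq_finrank] at h3
  rcases Nat.eq_zero_or_pos (Module.finrank k ↥(V ^ n)) with h0 | h0
  · omega
  have hlog : (0 : ℝ) < Real.log n := Real.log_pos (by exact_mod_cast h4)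
  have hl : ENNReal.log ((Module.finrank k ↥(V ^ n) : ℕ) : ENNReal)
      = ((Real.log (Module.finrank k ↥(V ^ n)) : ℝ) : EReal) := by
    rw [ENNReal.log_pos_real (by simp; omega) (by simp)]
    simp
  rw [hl, ← EReal.coe_div, EReal.coe_lt_coe_iff, div_lt_iff₀ hlog, ← Real.log_pow] at h3
  have h5 := (Real.log_lt_log_iff (by exact_mod_cast h0)
    (by positivity)).1 h3
  exact_mod_cast h5.le

end GK

/-! ### Total degree and independence of powers -/

section TotalDegree

variable {A : Type v} [Ring A] {d : ℕ}

/-- The ring homomorphism `A[t₁, …, t_d] → A[t₁, …, t_d][X]` that multiplies the component of total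
degree `n` by `X ^ n`. -/
def homogenize : MvPoly A d →+* (MvPoly A d)[X] :=
  AddMonoidAlgebra.liftNCRingHom
    (Polynomial.C.comp AddMonoidAlgebra.singleZeroRingHom)
    { toFun := fun m => Polynomial.monomial (Finsupp.degree m.toAdd)
        (AddMonoidAlgebra.single m.toAdd 1)
      map_one' := by simp [← AddMonoidAlgebra.one_def]
      map_mul' := fun m n => by
        simp [Polynomial.monomial_mul_monomial, AddMonoidAlgebra.single_mul_single] }
    (fun a m => by
      simp [Commute, SemiconjBy, Polynomial.C_mul_monomial, Polynomial.monomial_mul_C,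
        AddMonoidAlgebra.single_mul_single])

theorem homogenize_single (m : Fin d →₀ ℕ) (a : A) :
    homogenize (AddMonoidAlgebra.single m a)
      = Polynomial.monomial m.degree (AddMonoidAlgebra.single m a) := by
  simp [homogenize, AddMonoidAlgebra.liftNCRingHom, Polynomial.C_mul_monomial,
    AddMonoidAlgebra.single_mul_single]

theorem coeff_coeff_homogenize (y : MvPoly A d) (m : Fin d →₀ ℕ) :
    ((homogenize y).coeff m.degree).coeff m = y.coeff m := by
  induction y using AddMonoidAlgebra.induction_linear with
  | zero => simp
  | add f g hf hg => simp [hf, hg]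
  | single n a =>
    rw [homogenize_single, Polynomial.coeff_monomial]
    by_cases h : n = m
    · subst h; simp
    · split_ifs <;> simp [h]

/-- The powers of a nonconstant polynomial over a domain are linearly independent over
the constants. -/
theorem eq_zero_of_sum_mul_pow_eq_zero [IsDomain A] {z : MvPoly A d}
    (hz : ∀ a : A, z ≠ AddMonoidAlgebra.single 0 a) (n : ℕ) (c : Fin n → A)
    (h : ∑ i, AddMonoidAlgebra.single 0 (c i) * z ^ (i : ℕ) = 0) : c = 0 := by
  set p : (MvPoly A d)[X] :=
    ∑ i : Fin n, Polynomial.monomial (i : ℕ) (AddMonoidAlgebra.single 0 (c i)) with hp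
  -- `homogenize` fixes constants, so the relation becomes a composition in one variable over a
  -- domain: either `p = 0` or `homogenize z` has degree zero in `X`, and then `z` is constant.
  have hcomp : p.comp (homogenize z) = 0 := by
    rw [hp, Polynomial.sum_comp, ← map_zero homogenize, ← h, map_sum]
    refine Finset.sum_congr rfl fun i _ => ?_
    rw [Polynomial.monomial_comp, map_mul, map_pow, homogenize_single]
    simp
  rcases Polynomial.comp_eq_zero_iff.1 hcomp with h0 | ⟨-, h0⟩
  · ext i
    have := congrArg (fun q => (q.coeff (i : ℕ)).coeff 0) h0
    simpa [hp, Polynomial.finsetSum_coeff, Polynomial.coeff_monomial, Fin.val_inj] using this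
  · refine absurd ?_ (hz (z.coeff 0))
    ext m
    rw [← coeff_coeff_homogenize z m]
    by_cases hm : m = 0
    · subst hm; rw [coeff_coeff_homogenize]; simp
    · rw [h0, Polynomial.coeff_C_of_ne_zero]
      · simp [Ne.symm hm]
      · rwa [Ne, Finsupp.degree_eq_zero_iff]

end TotalDegree

/-! ### Filtration by boxes -/

section Filtration

variable {k : Type u} [CommRing k] {A : Type v} [Ring A] [Algebra k A]

/-- The polynomials with coefficients in `V ^ N` whose degree in each variable is at most `N`. -/
def boxed (V : Submodule k A) (d N : ℕ) : Submodule k (MvPoly A d) where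
  carrier := {f | ∀ m, f.coeff m ∈ V ^ N ∧ ((∃ j, N < m j) → f.coeff m = 0)}
  zero_mem' := fun m => by simp
  add_mem' := fun {f g} hf hg m =>
    ⟨by simpa using add_mem (hf m).1 (hg m).1, fun h => by simp [(hf m).2 h, (hg m).2 h]⟩
  smul_mem' := fun c f hf m =>
    ⟨by simpa using Submodule.smul_mem _ c (hf m).1, fun h => by simp [(hf m).2 h]⟩

variable {V : Submodule k A} {d : ℕ}

theorem single_mem_boxed {N : ℕ} {m : Fin d →₀ ℕ} {a : A} (hm : ∀ j, m j ≤ N) (ha : a ∈ V ^ N) :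
    AddMonoidAlgebra.single m a ∈ boxed V d N := by
  intro n
  by_cases h : m = n
  · subst h
    exact ⟨by simpa using ha, fun ⟨j, hj⟩ => absurd (hm j) (by omega)⟩
  · simp [h]

theorem boxed_induction {N : ℕ} {p : MvPoly A d → Prop} {f : MvPoly A d} (hf : f ∈ boxed V d N)
    (zero : p 0) (add : ∀ x y, p x → p y → p (x + y))
    (single : ∀ m a, (∀ j, m j ≤ N) → a ∈ V ^ N → p (AddMonoidAlgebra.single m a)) : p f := by
  rw [← AddMonoidAlgebra.sum_coeff_single f]
  refine Finset.sum_induction _ p add zero fun m hm => ?_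
  refine single m _ (fun j => ?_) (hf m).1
  by_contra! hj
  exact (Finsupp.mem_support_iff.1 hm) ((hf m).2 ⟨j, hj⟩)

theorem mul_mem_boxed {M N : ℕ} {f g : MvPoly A d} (hf : f ∈ boxed V d M) (hg : g ∈ boxed V d N) :
    f * g ∈ boxed V d (M + N) := by
  refine boxed_induction (p := fun f => f * g ∈ _) hf (by simp)
    (fun x y hx hy => by rw [add_mul]; exact add_mem hx hy) ?_
  intro m a hm ha
  refine boxed_induction (p := fun g => _ * g ∈ _) hg (by simp)
    (fun x y hx hy => by rw [mul_add]; exact add_mem hx hy) ?_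
  intro n b hn hb
  rw [AddMonoidAlgebra.single_mul_single]
  refine single_mem_boxed (fun j => by simpa using add_le_add (hm j) (hn j)) ?_
  rw [pow_add]
  exact Submodule.mul_mem_mul ha hb

theorem boxed_mono (hV : 1 ≤ V) {M N : ℕ} (h : M ≤ N) : boxed V d M ≤ boxed V d N := by
  intro f hf m
  exact ⟨pow_le_pow_right' hV h (hf m).1,
    fun ⟨j, hj⟩ => (hf m).2 ⟨j, by omega⟩⟩

theorem one_mem_boxed (N : ℕ) (hV : 1 ≤ V) : (1 : MvPoly A d) ∈ boxed V d N := by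
  rw [AddMonoidAlgebra.one_def]
  refine single_mem_boxed (by simp) ?_
  exact Submodule.one_le.1 (one_le_pow_of_one_le' hV N)

theorem pow_mem_boxed (hV : 1 ≤ V) {M : ℕ} {f : MvPoly A d} (hf : f ∈ boxed V d M) (n : ℕ) :
    f ^ n ∈ boxed V d (n * M) := by
  induction n with
  | zero => simpa using one_mem_boxed 0 hV
  | succ n ih => rw [pow_succ, add_mul, one_mul]; exact mul_mem_boxed ih hf

theorem exists_mem_boxed (hV : 1 ≤ V) (hgen : ∀ a : A, ∃ n, a ∈ V ^ n) (f : MvPoly A d) :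
    ∃ N, f ∈ boxed V d N := by
  induction f using AddMonoidAlgebra.induction_linear with
  | zero => exact ⟨0, zero_mem _⟩
  | add f g hf hg =>
    obtain ⟨m, hm⟩ := hf
    obtain ⟨n, hn⟩ := hg
    exact ⟨m + n, add_mem (boxed_mono hV (by omega) hm) (boxed_mono hV (by omega) hn)⟩
  | single m a =>
    obtain ⟨n, hn⟩ := hgen a
    refine ⟨n + m.degree, single_mem_boxed (fun j => ?_) (pow_le_pow_right' hV (by omega) hn)⟩
    exact (Finsupp.le_degree j m).trans (by omega)

/-- Restriction of the coefficients of a polynomial to a box. -/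
def boxCoeff (V : Submodule k A) (d N : ℕ) :
    boxed V d N →ₗ[k] ((Fin d → Fin (N + 1)) → ↥(V ^ N)) where
  toFun f b := ⟨f.1.coeff (Finsupp.equivFunOnFinite.symm fun j => (b j : ℕ)), (f.2 _).1⟩
  map_add' f g := by ext; simp
  map_smul' c f := by ext; simp

theorem boxCoeff_injective (V : Submodule k A) (d N : ℕ) :
    Function.Injective (boxCoeff V d N) := by
  rw [injective_iff_map_eq_zero]
  intro f hf
  ext m
  by_cases h : ∃ j, N < m j
  · exact (f.2 m).2 h
  · push Not at h
    have := congrArg Subtype.val (congrFun hf fun j => ⟨m j, Nat.lt_succ_of_le (h j)⟩)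
    simpa [boxCoeff] using this

end Filtration

/-! ### Comparing growth on both sides -/

section Comparison

variable {k : Type u} [CommRing k] {A : Type v} [Ring A] [Algebra k A] {d : ℕ}

/-- The map sending a family `x` to `∑ x (i, b) * z ^ i * s b`. -/
def boxSum {V : Submodule k A} (n N : ℕ) (z : MvPoly A d)
    (s : (Fin d → Fin (n + 1)) → MvPoly A d)
    (h : ∀ a ∈ V ^ n, ∀ (i : Fin (n + 1)) b,
      AddMonoidAlgebra.single 0 a * z ^ (i : ℕ) * s b ∈ boxed V d N) :
    ((Fin (n + 1) × (Fin d → Fin (n + 1))) → ↥(V ^ n)) →ₗ[k] boxed V d N where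
  toFun x := ⟨∑ p, AddMonoidAlgebra.single 0 (x p : A) * z ^ (p.1 : ℕ) * s p.2,
    Submodule.sum_mem _ fun p _ => h _ (x p).2 _ _⟩
  map_add' x y := by
    ext1
    simp [AddMonoidAlgebra.single_add, add_mul, Finset.sum_add_distrib]
  map_smul' c x := by
    ext1
    simp [← AddMonoidAlgebra.smul_single, Finset.smul_sum]

variable {B : Type w} [Ring B] [Algebra k B]

theorem symm_single_mem_boxed {V : Submodule k A} (hV : 1 ≤ V)
    (φ : MvPoly A d ≃ₐ[k] MvPoly B d) {M : ℕ}
    (hM : ∀ j, φ.symm (AddMonoidAlgebra.single (Finsupp.single j 1) 1) ∈ boxed V d M)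
    (m : Fin d →₀ ℕ) : φ.symm (AddMonoidAlgebra.single m 1) ∈ boxed V d (m.degree * M) := by
  induction m using Finsupp.induction_linear with
  | zero =>
    rw [← AddMonoidAlgebra.one_def, map_one]
    exact one_mem_boxed _ hV
  | add m n hm hn =>
    have : (AddMonoidAlgebra.single (m + n) 1 : MvPoly B d)
        = AddMonoidAlgebra.single m 1 * AddMonoidAlgebra.single n 1 := by
      simp [AddMonoidAlgebra.single_mul_single]
    rw [this, map_mul, map_add, add_mul]
    exact mul_mem_boxed hm hn
  | single j n =>
    have : (AddMonoidAlgebra.single (Finsupp.single j n) 1 : MvPoly B d)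
        = AddMonoidAlgebra.single (Finsupp.single j 1) 1 ^ n := by
      simp [AddMonoidAlgebra.single_pow]
    rw [this, map_pow, Finsupp.degree_single]
    exact pow_mem_boxed hV (hM j) n

theorem boxSum_injective [IsDomain A] {V : Submodule k A} (φ : MvPoly A d ≃ₐ[k] MvPoly B d)
    (hφ : ∀ a : A, ∃ b : B, φ (AddMonoidAlgebra.single 0 a) = AddMonoidAlgebra.single 0 b)
    {β : B} (hβ : ∀ a : A, φ.symm (AddMonoidAlgebra.single 0 β) ≠ AddMonoidAlgebra.single 0 a)
    (n N : ℕ)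
    (h : ∀ a ∈ V ^ n, ∀ (i : Fin (n + 1)) (b : Fin d → Fin (n + 1)),
      AddMonoidAlgebra.single 0 a * φ.symm (AddMonoidAlgebra.single 0 β) ^ (i : ℕ) *
        φ.symm (AddMonoidAlgebra.single (Finsupp.equivFunOnFinite.symm fun j => (b j : ℕ)) 1)
        ∈ boxed V d N) :
    Function.Injective (boxSum n N _ _ h) := by
  rw [injective_iff_map_eq_zero]
  intro x hx
  choose g hg using hφ
  -- Under `φ` the coefficients and `z` land in `B`, while the last factor becomes the monomial `t ^
  -- b`; comparing coefficients separates the indices `b`.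
  have key : ∀ b, ∑ i, g (x (i, b)) * β ^ (i : ℕ) = 0 := by
    intro b
    have h1 := congrArg (fun y => (φ y.1).coeff
      (Finsupp.equivFunOnFinite.symm fun j => (b j : ℕ))) hx
    have h2 : ∀ b' : Fin d → Fin (n + 1),
        (Finsupp.equivFunOnFinite.symm fun j => (b' j : ℕ))
          = (Finsupp.equivFunOnFinite.symm fun j => (b j : ℕ)) ↔ b' = b := fun b' => by
      rw [EmbeddingLike.apply_eq_iff_eq, funext_iff, funext_iff]
      simp [Fin.val_inj]
    simpa [boxSum, hg, AddMonoidAlgebra.single_pow, AddMonoidAlgebra.single_mul_single,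
      Fintype.sum_prod_type, Finsupp.single_apply, h2, Finsupp.finsetSum_apply] using h1
  ext ⟨i, b⟩
  -- Pulled back along `φ`, the relation says that a combination of powers of `z` over `A` vanishes.
  have := eq_zero_of_sum_mul_pow_eq_zero hβ (n + 1) (fun i => (x (i, b) : A)) (φ.injective (by
    simp only [map_sum, map_mul, map_pow, hg, AlgEquiv.apply_symm_apply,
      AddMonoidAlgebra.single_pow, AddMonoidAlgebra.single_mul_single, map_zero]
    simp only [nsmul_zero, add_zero]
    rw [← map_zero (AddMonoidAlgebra.singleAddHom (0 : Fin d →₀ ℕ)), ← key b, map_sum]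
    rfl))
  simpa using congrFun this i

/-- If an isomorphism of polynomial rings maps `A` into `B`, then it maps `A` onto `B`. -/
theorem symm_single_zero_eq_single_zero [IsDomain k] [IsDomain A] (hfg : Algebra.FiniteType k A)
    (hGK : HasFiniteGKdim k A) (φ : MvPoly A d ≃ₐ[k] MvPoly B d)
    (hφ : ∀ a : A, ∃ b : B, φ (AddMonoidAlgebra.single 0 a) = AddMonoidAlgebra.single 0 b)
    (β : B) : ∃ a : A, φ.symm (AddMonoidAlgebra.single 0 β) = AddMonoidAlgebra.single 0 a := by
  by_contra! hβ
  obtain ⟨V, hVfg, hV, hgen⟩ := exists_fg_forall_mem_pow hfg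
  have hfin : ∀ n, Module.Finite k ↥(V ^ n) := fun n => Module.Finite.of_fg (hVfg.pow n)
  have hinj := algebraMap_injective_of_hasFiniteGKdim hGK
  obtain ⟨M₀, hM₀⟩ := exists_mem_boxed hV hgen (φ.symm (AddMonoidAlgebra.single 0 β))
  choose M₁ hM₁ using fun j : Fin d => exists_mem_boxed hV hgen
    (φ.symm (AddMonoidAlgebra.single (Finsupp.single j 1) 1))
  set M := M₀ + ∑ j, M₁ j
  have hM₀ : φ.symm (AddMonoidAlgebra.single 0 β) ∈ boxed V d M :=
    boxed_mono hV (Nat.le_add_right _ _) hM₀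
  have hM₁ : ∀ j, φ.symm (AddMonoidAlgebra.single (Finsupp.single j 1) 1) ∈ boxed V d M :=
    fun j => boxed_mono hV ((Finset.single_le_sum (fun _ _ => Nat.zero_le _)
      (Finset.mem_univ j)).trans (Nat.le_add_left _ _)) (hM₁ j)
  -- The three terms pay for `a`, for `z ^ i` and for the preimage of a monomial of degree at most
  -- `d * n`.
  set c := 1 + M + d * M
  have hmem : ∀ n, ∀ a ∈ V ^ n, ∀ (i : Fin (n + 1)) (b : Fin d → Fin (n + 1)),
      AddMonoidAlgebra.single 0 a * φ.symm (AddMonoidAlgebra.single 0 β) ^ (i : ℕ) *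
        φ.symm (AddMonoidAlgebra.single (Finsupp.equivFunOnFinite.symm fun j => (b j : ℕ)) 1)
        ∈ boxed V d (c * n) := by
    intro n a ha i b
    have hdeg : (Finsupp.equivFunOnFinite.symm fun j => (b j : ℕ)).degree ≤ d * n := by
      rw [Finsupp.degree_eq_sum]
      refine (Finset.sum_le_card_nsmul _ _ n fun j _ => ?_).trans (by simp)
      simpa using Nat.le_of_lt_succ (b j).2
    refine boxed_mono hV ?_ (mul_mem_boxed (mul_mem_boxed
      (single_mem_boxed (m := 0) (by simp) ha) (pow_mem_boxed hV hM₀ i))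
      (symm_single_mem_boxed hV φ hM₁ _))
    have h1 := Nat.mul_le_mul_right M (Nat.le_of_lt_succ i.2)
    have h2 := Nat.mul_le_mul_right M hdeg
    calc _ ≤ n + n * M + d * n * M := by omega
      _ = c * n := by ring
  have hgrowth : ∀ n, Module.finrank k ↥(V ^ n) * (n + 1)
      ≤ c ^ d * Module.finrank k ↥(V ^ (c * n)) := by
    intro n
    have h1 := LinearMap.finrank_le_finrank_of_injective (f := boxCoeff V d (c * n) ∘ₗ
      boxSum n (c * n) _ _ (hmem n)) ((boxCoeff_injective V d (c * n)).comp
        (boxSum_injective φ hφ hβ n (c * n) (hmem n)))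
    rw [finrank_fun, finrank_fun] at h1
    simp only [Fintype.card_prod, Fintype.card_fin, Fintype.card_pi, Finset.prod_const,
      Finset.card_univ] at h1
    have h2 : c * n + 1 ≤ c * (n + 1) := by simp only [c]; ring_nf; omega
    have h3 := Nat.mul_le_mul_right (Module.finrank k ↥(V ^ (c * n))) (Nat.pow_le_pow_left h2 d)
    -- The monomials `t ^ b` cancel against the box in `d` variables; the powers of `z` leave one
    -- factor `n + 1`.
    refine Nat.le_of_mul_le_mul_right (c := (n + 1) ^ d) ?_ (by positivity)
    calc _ = _ := by ring
      _ ≤ _ := h1.trans h3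
      _ = _ := by rw [mul_pow]; ring
  have hpos : ∀ n, 1 ≤ Module.finrank k ↥(V ^ n) := by
    intro n
    have : FaithfulSMul k A := (faithfulSMul_iff_algebraMap_injective k A).2 hinj
    have : Nontrivial ↥(V ^ n) :=
      ⟨⟨⟨1, Submodule.one_le.1 (one_le_pow_of_one_le' hV n)⟩, 0, fun h =>
        one_ne_zero (congrArg Subtype.val h)⟩⟩
    exact Module.finrank_pos
  obtain ⟨R, N, hR⟩ := hGK.exists_finrank_pow_le hVfg
  exact not_polynomially_bounded hpos (c := c) (by omega) hgrowth R
    ⟨1, N, fun n hn => by simpa using hR n hn⟩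

end Comparison

/-! ### Exponentials of iterative higher derivations -/

section Exponential

variable {k : Type u} [CommRing k] {A : Type v} [Ring A] [Algebra k A] {D : ℕ → A →ₗ[k] A}

theorem exists_polynomial_coeff_eq (hfin : ∀ a : A, ∃ n : ℕ, ∀ i, n ≤ i → D i a = 0) (a : A) :
    ∃ p : A[X], ∀ i, p.coeff i = D i a := by
  obtain ⟨N, hN⟩ := hfin a
  refine ⟨∑ i ∈ Finset.range N, Polynomial.monomial i (D i a), fun i => ?_⟩
  simp only [Polynomial.finsetSum_coeff, Polynomial.coeff_monomial, Finset.sum_ite_eq',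
    Finset.mem_range]
  split_ifs with h
  · rfl
  · exact (hN i (not_lt.1 h)).symm

/-- A locally finite higher derivation `D` gives an algebra homomorphism
`a ↦ ∑ D i a * X ^ i`. -/
theorem exists_expAlgHom (hD : D ∈ DerH k A) (h1 : ∀ n, n ≠ 0 → D n 1 = 0)
    (hfin : ∀ a : A, ∃ n : ℕ, ∀ i, n ≤ i → D i a = 0) :
    ∃ E : A →ₐ[k] A[X], ∀ a i, (E a).coeff i = D i a := by
  choose p hp using exists_polynomial_coeff_eq hfin
  refine ⟨AlgHom.ofLinearMap
    { toFun := p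
      map_add' := fun a b => by ext i; simp [hp]
      map_smul' := fun c a => by ext i; simp [hp] } ?_ ?_, hp⟩
  · ext i
    by_cases hi : i = 0
    · subst hi; simp [hp, hD.1]
    · simp [hp, h1 i hi, Polynomial.coeff_one, hi]
  · intro a b
    ext i
    simp [hp, hD.2, Polynomial.coeff_mul,
      Finset.Nat.sum_antidiagonal_eq_sum_range_succ fun m n => D m a * D n b]

/-- Extending the exponential by `X ↦ -X` gives an involution `τ`: the coefficient of `X ^ n` in `τ
(E a)` is the alternating sum of the `n.choose i` times `D n a`. Composing with the sign change `σ`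
restores `X ↦ X`. -/
theorem mem_LNDI_of_iterative (hD : D ∈ DerH k A) (h1 : ∀ n, n ≠ 0 → D n 1 = 0)
    (hfin : ∀ a : A, ∃ n : ℕ, ∀ i, n ≤ i → D i a = 0)
    (hit : ∀ i j : ℕ, D i ∘ₗ D j = (i + j).choose i • D (i + j)) : D ∈ LNDI k A := by
  obtain ⟨E, hE⟩ := exists_expAlgHom hD h1 hfin
  have hcomm : ∀ p : A[X], Commute p (-Polynomial.X) := fun p =>
    (Polynomial.commute_X p).symm.neg_right
  let τ : A[X] →ₐ[k] A[X] := Polynomial.eval₂AlgHom E (-Polynomial.X) fun _ => hcomm _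
  let σ : A[X] →ₐ[k] A[X] :=
    Polynomial.eval₂AlgHom Polynomial.CAlgHom (-Polynomial.X) fun _ => hcomm _
  have hτC : ∀ a, τ (Polynomial.C a) = E a := fun a => by simp [τ]
  have hτX : τ Polynomial.X = -Polynomial.X := by simp [τ]
  have hσC : ∀ a, σ (Polynomial.C a) = Polynomial.C a := fun a => by simp [σ]
  have hσX : σ Polynomial.X = -Polynomial.X := by simp [σ]
  have hσσ : σ.comp σ = AlgHom.id k _ := by
    ext <;> simp [hσX, hσC]
  have hτE : ∀ a, τ (E a) = Polynomial.C a := by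
    intro a
    ext n
    -- The range covers both the degree of `E a` and all `i ≤ n`; terms with `i > n` vanish.
    rw [(E a).as_sum_range' (n + 1 + (E a).natDegree) (by omega), map_sum,
      Polynomial.finsetSum_coeff]
    have hterm : ∀ i, (τ (Polynomial.monomial i ((E a).coeff i))).coeff n
        = ((-1) ^ i * (n.choose i : ℤ)) • D n a := by
      intro i
      rw [← Polynomial.C_mul_X_pow_eq_monomial, map_mul, map_pow, hτC, hτX, hE, neg_pow,
        ← mul_assoc, Polynomial.coeff_mul_X_pow']
      split_ifs with hi
      · have h := LinearMap.congr_fun (hit (n - i) i) a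
        rw [LinearMap.comp_apply, LinearMap.smul_apply, Nat.sub_add_cancel hi,
          Nat.choose_symm hi] at h
        rcases Nat.even_or_odd i with hp | hp <;> simp [hp.neg_one_pow, hE, h]
      · rw [Nat.choose_eq_zero_of_lt (not_le.1 hi)]
        simp
    rw [Finset.sum_congr rfl fun i _ => hterm i, ← Finset.sum_smul,
      ← Finset.sum_subset (Finset.range_mono (show n + 1 ≤ _ by omega)),
      Int.alternating_sum_range_choose]
    · by_cases hn : n = 0
      · subst hn; simp [hD.1]
      · simp [hn, Polynomial.coeff_C]
    · intro i _ hi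
      rw [Nat.choose_eq_zero_of_lt (by simpa using hi)]
      simp
  have hττ : τ.comp τ = AlgHom.id k _ := by
    ext <;> simp [hτX, hτC, hτE]
  refine ⟨⟨hD, hfin, (AlgEquiv.ofAlgHom σ σ hσσ hσσ).trans (AlgEquiv.ofAlgHom τ τ hττ hττ), ?_, ?_⟩,
    hit⟩
  · intro a i
    simp [hσC, hτC, hE]
  · simp [hσX, hτX]

/-- Iterativity gives `D 1 ^ n = n! • D n`. -/
theorem one_mem_LND_of_iterative (hD : D ∈ DerH k A)
    (hfin : ∀ a : A, ∃ n : ℕ, ∀ i, n ≤ i → D i a = 0)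
    (hit : ∀ i j : ℕ, D i ∘ₗ D j = (i + j).choose i • D (i + j)) : D 1 ∈ LND k A := by
  have hpow : ∀ n : ℕ, D 1 ^ n = n.factorial • D n := by
    intro n
    induction n with
    | zero => simp [hD.1]; rfl
    | succ n ih =>
      rw [pow_succ', ih, mul_smul_comm, Module.End.mul_eq_comp, hit, smul_smul, add_comm 1 n,
        Nat.choose_one_right, Nat.factorial_succ, mul_comm]
  refine ⟨fun a b => ?_, fun a => ?_⟩
  · rw [hD.2, Finset.sum_range_succ, Finset.sum_range_one, add_comm]
    simp [hD.1]
  · obtain ⟨n, hn⟩ := hfin a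
    exact ⟨n, by rw [hpow, LinearMap.smul_apply, hn n le_rfl, smul_zero]⟩

end Exponential

/-! ### Hasse derivatives and the bound on ML -/

section Hasse

variable {k : Type u} [CommRing k] {B : Type w} [Ring B] [Algebra k B] {d : ℕ}

variable (k B) in
/-- The Hasse derivatives of `B[t₁, …, t_d]` in the direction of `t_j`. -/
def hasse (j : Fin d) (n : ℕ) : MvPoly B d →ₗ[k] MvPoly B d where
  toFun f := f.coeff.sum fun m b =>
    AddMonoidAlgebra.single (m - Finsupp.single j n) ((m j).choose n • b)
  map_add' f g := by
    rw [AddMonoidAlgebra.coeff_add, Finsupp.sum_add_index'] <;> simp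
  map_smul' c f := by
    rw [AddMonoidAlgebra.coeff_smul, Finsupp.sum_smul_index' (by simp), RingHom.id_apply,
      Finsupp.smul_sum]
    simp

theorem hasse_single (j : Fin d) (n : ℕ) (m : Fin d →₀ ℕ) (b : B) :
    hasse k B j n (AddMonoidAlgebra.single m b)
      = AddMonoidAlgebra.single (m - Finsupp.single j n) ((m j).choose n • b) := by
  simp [hasse]

theorem coeff_hasse (j : Fin d) (n : ℕ) (f : MvPoly B d) (m : Fin d →₀ ℕ) :
    (hasse k B j n f).coeff m = (m j + n).choose n • f.coeff (m + Finsupp.single j n) := by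
  induction f using AddMonoidAlgebra.induction_linear with
  | zero => simp
  | add f g hf hg => simp [hf, hg]
  | single l b =>
    rw [hasse_single]
    by_cases h : l = m + Finsupp.single j n
    · subst h; simp
    · by_cases hn : n ≤ l j
      · have : l - Finsupp.single j n ≠ m := by
          rintro rfl
          exact h (tsub_add_cancel_of_le (by simpa using hn)).symm
        simp [h, this]
      · simp [h, Nat.choose_eq_zero_of_lt (not_le.1 hn)]

theorem hasse_mem_DerH (j : Fin d) : hasse k B j ∈ DerH k (MvPoly B d) := by
  refine ⟨?_, fun n f g => ?_⟩
  · ext f m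
    simp [coeff_hasse]
  induction f using AddMonoidAlgebra.induction_linear with
  | zero => simp
  | add f₁ f₂ h₁ h₂ => simp [add_mul, h₁, h₂, Finset.sum_add_distrib]
  | single m a =>
  induction g using AddMonoidAlgebra.induction_linear with
  | zero => simp
  | add f₁ f₂ h₁ h₂ => simp [mul_add, h₁, h₂, Finset.sum_add_distrib]
  | single l b =>
    -- On monomials the Leibniz rule is Vandermonde's identity. Where the subtraction of exponents
    -- truncates, the binomial coefficient is zero.
    rw [AddMonoidAlgebra.single_mul_single, hasse_single, Finsupp.add_apply, Nat.add_choose_eq,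
      Finset.Nat.sum_antidiagonal_eq_sum_range_succ fun x y => (m j).choose x * (l j).choose y,
      Finset.sum_smul]
    refine (map_sum (AddMonoidAlgebra.singleAddHom _) _ _).trans (Finset.sum_congr rfl fun i hi => ?_)
    have hi : i ≤ n := Nat.lt_succ_iff.1 (Finset.mem_range.1 hi)
    rw [hasse_single, hasse_single, AddMonoidAlgebra.single_mul_single,
      AddMonoidAlgebra.singleAddHom_apply, smul_mul_smul_comm]
    by_cases h1 : i ≤ m j
    · by_cases h2 : n - i ≤ l j
      · congr 1
        ext x
        by_cases hx : x = j
        · subst hx; simp; omega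
        · simp [Ne.symm hx]
      · simp [Nat.choose_eq_zero_of_lt (not_le.1 h2)]
    · simp [Nat.choose_eq_zero_of_lt (not_le.1 h1)]

theorem hasse_one (j : Fin d) (n : ℕ) (hn : n ≠ 0) : hasse k B j n 1 = 0 := by
  rw [AddMonoidAlgebra.one_def, hasse_single]
  simp [Nat.choose_eq_zero_of_lt (Nat.pos_of_ne_zero hn)]

theorem exists_hasse_eq_zero (j : Fin d) (f : MvPoly B d) :
    ∃ n : ℕ, ∀ i, n ≤ i → hasse k B j i f = 0 := by
  induction f using AddMonoidAlgebra.induction_linear with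
  | zero => simp
  | add f g hf hg =>
    obtain ⟨m, hm⟩ := hf
    obtain ⟨n, hn⟩ := hg
    exact ⟨m + n, fun i hi => by rw [map_add, hm i (by omega), hn i (by omega), add_zero]⟩
  | single l b =>
    refine ⟨l j + 1, fun i hi => ?_⟩
    rw [hasse_single, Nat.choose_eq_zero_of_lt hi]
    simp

theorem hasse_comp_hasse (j : Fin d) (i l : ℕ) :
    hasse k B j i ∘ₗ hasse k B j l = (i + l).choose i • hasse k B j (i + l) := by
  refine LinearMap.ext fun f => ?_
  ext m
  simp only [LinearMap.comp_apply, LinearMap.smul_apply, coeff_hasse,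
    AddMonoidAlgebra.coeff_smul, Finsupp.smul_apply, smul_smul, add_assoc, Finsupp.add_apply,
    Finsupp.single_eq_same, ← Finsupp.single_add]
  congr 1
  have h := Nat.choose_mul (n := m j + (i + l)) (Nat.le_add_left l i)
  rw [← Nat.choose_symm_add (a := i), show m j + (i + l) - l = m j + i by omega,
    Nat.add_sub_cancel] at h
  linarith

/-- If `m j ≠ 0`, the Hasse derivative of order `m j` moves the coefficient at `m` with factor `1`,
in any characteristic. The ordinary derivative gives the factor `m j`, hence the torsion condition
in the blank case. -/
theorem ML_le_constMvPoly (s : Star)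
    (hs : s = Star.blank → ∀ (n : ℕ) (b : B), n ≠ 0 → n • b = 0 → b = 0) :
    ML s k (MvPoly B d) ≤ constMvPoly k B d := by
  intro f hf
  have key : ∀ (m : Fin d →₀ ℕ), m ≠ 0 → f.coeff m = 0 := by
    intro m hm
    obtain ⟨j, hj⟩ := Finsupp.ne_iff.1 hm
    have hj : m j ≠ 0 := hj
    have hI := mem_LNDI_of_iterative (hasse_mem_DerH (k := k) (B := B) j) (hasse_one j)
      (exists_hasse_eq_zero j) (hasse_comp_hasse j)
    have hH : (∀ i, 1 ≤ i → hasse k B j i f = 0) → f.coeff m = 0 := by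
      intro h
      have := congrArg (fun g => g.coeff (m - Finsupp.single j (m j))) (h (m j) (by omega))
      simp only [coeff_hasse] at this
      rw [tsub_add_cancel_of_le (by simp)] at this
      simpa using this
    cases s with
    | blank =>
      simp only [ML, Submodule.mem_iInf, LinearMap.mem_ker] at hf
      have h := hf _ (one_mem_LND_of_iterative (hasse_mem_DerH (k := k) (B := B) j)
        (exists_hasse_eq_zero j) (hasse_comp_hasse j))
      have := congrArg (fun g => g.coeff (m - Finsupp.single j 1)) h
      simp only [coeff_hasse] at this
      rw [tsub_add_cancel_of_le (by simp; omega)] at this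
      exact hs rfl _ _ (by simp) this
    | H =>
      simp only [ML, kerH, Submodule.mem_iInf, LinearMap.mem_ker] at hf
      exact hH (hf _ hI.1)
    | I =>
      simp only [ML, kerH, Submodule.mem_iInf, LinearMap.mem_ker] at hf
      exact hH (hf _ hI)
  refine ⟨f.coeff 0, ?_⟩
  ext m
  by_cases hm : m = 0
  · subst hm; simp
  · simp [key m hm, Ne.symm hm]

end Hasse

/-! ### Invariance of ML under isomorphism -/

section Transport

variable {k : Type u} [CommRing k] {A : Type v} [Ring A] [Algebra k A] {B : Type w} [Ring B]
  [Algebra k B] (e : A ≃ₐ[k] B)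

/-- Conjugation of an endomorphism by an isomorphism. -/
def conjEnd (δ : B →ₗ[k] B) : A →ₗ[k] A :=
  e.symm.toLinearMap ∘ₗ δ ∘ₗ e.toLinearMap

@[simp]
theorem conjEnd_apply (δ : B →ₗ[k] B) (a : A) : conjEnd e δ a = e.symm (δ (e a)) := rfl

theorem conjEnd_pow_apply (δ : B →ₗ[k] B) (n : ℕ) (a : A) :
    (conjEnd e δ ^ n) a = e.symm ((δ ^ n) (e a)) := by
  induction n with
  | zero => simp
  | succ n ih => simp [pow_succ', ih]

theorem conjEnd_mem_LND {δ : B →ₗ[k] B} (h : δ ∈ LND k B) : conjEnd e δ ∈ LND k A := by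
  refine ⟨fun a b => by simp [h.1], fun a => ?_⟩
  obtain ⟨n, hn⟩ := h.2 (e a)
  exact ⟨n, by rw [conjEnd_pow_apply, hn, map_zero]⟩

theorem conjEnd_mem_LNDH {D : ℕ → B →ₗ[k] B} (h : D ∈ LNDH k B) :
    (fun n => conjEnd e (D n)) ∈ LNDH k A := by
  obtain ⟨⟨h0, hmul⟩, hfin, G, hG, hX⟩ := h
  refine ⟨⟨?_, fun n a b => by simp [hmul]⟩, fun a => ?_,
    ((Polynomial.mapAlgEquiv e).trans G).trans (Polynomial.mapAlgEquiv e).symm, fun a i => ?_, ?_⟩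
  · ext a; simp [h0]
  · obtain ⟨n, hn⟩ := hfin (e a)
    exact ⟨n, fun i hi => by simp [hn i hi]⟩
  · simp [Polynomial.mapAlgEquiv, hG]
  · simp [Polynomial.mapAlgEquiv, hX]

theorem conjEnd_mem_LNDI {D : ℕ → B →ₗ[k] B} (h : D ∈ LNDI k B) :
    (fun n => conjEnd e (D n)) ∈ LNDI k A := by
  refine ⟨conjEnd_mem_LNDH e h.1, fun i j => ?_⟩
  ext a
  simpa using congrArg e.symm (LinearMap.congr_fun (h.2 i j) (e a))

theorem apply_mem_ML (s : Star) {a : A} (ha : a ∈ ML s k A) : e a ∈ ML s k B := by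
  cases s with
  | blank =>
    simp only [ML, Submodule.mem_iInf, LinearMap.mem_ker] at ha ⊢
    intro δ hδ
    simpa using ha _ (conjEnd_mem_LND e hδ)
  | H =>
    simp only [ML, kerH, Submodule.mem_iInf, LinearMap.mem_ker] at ha ⊢
    intro D hD i hi
    simpa using ha _ (conjEnd_mem_LNDH e hD) i hi
  | I =>
    simp only [ML, kerH, Submodule.mem_iInf, LinearMap.mem_ker] at ha ⊢
    intro D hD i hi
    simpa using ha _ (conjEnd_mem_LNDI e hD) i hi

end Transport

/-! ### From constants to the theorem -/

section Main

variable {k : Type u} [CommRing k]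

variable (k) in
/-- `A[t]` as a polynomial ring in one variable in the sense of `MvPoly`. -/
def polyEquivMvPoly (A : Type v) [Ring A] [Algebra k A] : A[X] ≃ₐ[k] MvPoly A 1 :=
  (AlgEquiv.ofRingEquiv (f := Polynomial.toFinsuppIso A) fun r => by
      rw [Polynomial.algebraMap_apply]
      simp).trans
    (AddMonoidAlgebra.domCongr k A (Finsupp.uniqueAddEquiv (0 : Fin 1)).symm)

theorem polyEquivMvPoly_C {A : Type v} [Ring A] [Algebra k A] (a : A) :
    polyEquivMvPoly k A (Polynomial.C a) = AddMonoidAlgebra.single 0 a := by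
  simp [polyEquivMvPoly]

variable {A : Type v} [Ring A] [Algebra k A] {B : Type w} [Ring B] [Algebra k B] {d : ℕ}

theorem nonempty_algEquiv_of_map_const (φ : MvPoly A d ≃ₐ[k] MvPoly B d)
    (h₁ : ∀ a : A, ∃ b : B, φ (AddMonoidAlgebra.single 0 a) = AddMonoidAlgebra.single 0 b)
    (h₂ : ∀ b : B, ∃ a : A, φ.symm (AddMonoidAlgebra.single 0 b) = AddMonoidAlgebra.single 0 a) :
    Nonempty (A ≃ₐ[k] B) := by
  let iA : A →ₐ[k] MvPoly A d := AddMonoidAlgebra.singleZeroAlgHom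
  let iB : B →ₐ[k] MvPoly B d := AddMonoidAlgebra.singleZeroAlgHom
  have hA : Function.Injective iA := fun x y h => by
    simpa [iA] using congrArg (fun f => f.coeff 0) h
  have hB : Function.Injective iB := fun x y h => by
    simpa [iB] using congrArg (fun f => f.coeff 0) h
  have hrange : iA.range.map (φ : MvPoly A d →ₐ[k] MvPoly B d) = iB.range := by
    ext y
    constructor
    · rintro ⟨_, ⟨a, rfl⟩, rfl⟩
      obtain ⟨b, hb⟩ := h₁ a
      exact ⟨b, hb.symm⟩
    · rintro ⟨b, rfl⟩
      obtain ⟨a, ha⟩ := h₂ b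
      exact ⟨_, ⟨a, ha.symm⟩, φ.apply_symm_apply _⟩
  exact ⟨(AlgEquiv.ofInjective iA hA).trans <| (φ.subalgebraMap iA.range).trans <|
    (Subalgebra.equivOfEq _ _ hrange).trans (AlgEquiv.ofInjective iB hB).symm⟩

theorem nonempty_algEquiv_of_ML_eq [IsDomain k] [IsDomain A] (hfg : Algebra.FiniteType k A)
    (hGK : HasFiniteGKdim k A) (s : Star) (hs : s = Star.blank → CharZero A)
    (hML : constMvPoly k A d ≤ ML s k (MvPoly A d)) (φ : MvPoly A d ≃ₐ[k] MvPoly B d) :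
    Nonempty (A ≃ₐ[k] B) := by
  -- Nothing is assumed about `B`; its additive torsion is excluded by embedding `B` in `A[t₁, …,
  -- t_d]`, where `A` is a domain of characteristic zero.
  have hs' : s = Star.blank → ∀ (n : ℕ) (b : B), n ≠ 0 → n • b = 0 → b = 0 := by
    intro h n b hn hb
    have := hs h
    have h1 : φ.symm (AddMonoidAlgebra.single 0 b) = 0 := by
      have h2 : n • φ.symm (AddMonoidAlgebra.single 0 b) = 0 := by
        rw [← map_nsmul, AddMonoidAlgebra.smul_single, hb]
        simp
      ext m
      have h3 : n • (φ.symm (AddMonoidAlgebra.single 0 b)).coeff m = 0 := by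
        rw [← Finsupp.smul_apply, ← AddMonoidAlgebra.coeff_smul, h2]
        simp
      simpa [hn] using h3
    simpa using h1
  have h₁ : ∀ a : A, ∃ b : B,
      φ (AddMonoidAlgebra.single 0 a) = AddMonoidAlgebra.single 0 b := by
    intro a
    obtain ⟨b, hb⟩ := ML_le_constMvPoly s hs' (apply_mem_ML φ s (hML ⟨a, rfl⟩))
    exact ⟨b, hb.symm⟩
  exact nonempty_algEquiv_of_map_const φ h₁ (symm_single_zero_eq_single_zero hfg hGK φ h₁)

end Main


end Cancellation

end

theorem theorem3p3
    (k : Type u) [CommRing k] [IsDomain k]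
    (A : Type v) [Ring A] [IsDomain A] [Algebra k A]
    (hfg : Algebra.FiniteType k A)
    (hGK : Cancellation.HasFiniteGKdim k A)
    (s : Cancellation.Star)
    (hs : s = Cancellation.Star.blank → CharZero A) :
    (Cancellation.IsStronglyRigid s k A → Cancellation.IsStronglyCancellative.{u, v, w} k A) ∧
    (Cancellation.ML s k (Polynomial A) = Cancellation.constPoly k A →
      Cancellation.IsCancellative.{u, v, w} k A) := by
  constructor
  · rintro h d hd B _ _ ⟨φ⟩
    exact Cancellation.nonempty_algEquiv_of_ML_eq hfg hGK s hs (h d hd).ge φ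
  · rintro h B _ _ ⟨φ⟩
    refine Cancellation.nonempty_algEquiv_of_ML_eq (d := 1) hfg hGK s hs ?_
      (((Cancellation.polyEquivMvPoly k A).symm.trans φ).trans (Cancellation.polyEquivMvPoly k B))
    rintro _ ⟨a, rfl⟩
    have := Cancellation.apply_mem_ML (Cancellation.polyEquivMvPoly k A) s
      (a := Polynomial.C a) (h.ge ⟨a, rfl⟩)
    rwa [Cancellation.polyEquivMvPoly_C] at this
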